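/- Let $P$ and $Q$ be arbitrary probability measures on a common measurable space, and let $\omega\in(0,1)$. Logarithms and exponentials are taken to a common arbitrary base $b>1$ (so $\exp(x)=b^x$ for the exponential of a relative entropy), $\mathrm e$ is Euler's number, and the conventions $\exp(-\infty)=0$, $a/\infty=0$ are used. For a convex $f:(0,\infty)\to\mathbb R$ with $f(1)=0$, and densities $p,q$ of $P,Q$ with respect to a dominating measure $\mu$ (e.g. $\mu=P+Q$), let $D_f(P\|Q)=\int q\,f(p/q)\,\mathrm d\mu$, where $f(0)=\lim_{t\downarrow0}f(t)$, $0f(0/0)=0$ and $0f(a/0)=a\lim_{u\to\infty}f(u)/u$ for $a>0$. The DeGroot statistical information $\mathcal I_\omega(P\|Q)$ is $D_{\phi_\omega}(P\|Q)$ with $\phi_\omega(t)=\min\{\omega,1-\omega\}-\min\{\omega t,1-\omega\}$, the chi-squared divergence $\chi^2(P\|Q)\in[0,\infty]$ is $D_f(P\|Q)$ with $f(t)=(t-1)^2$, and $D(P\|Q)\in[0,\infty]$ is the relative entropy. For $\gamma>1$ let $$c_\gamma=\frac{t_\gamma-\gamma}{t_\gamma\log t_\gamma+(1-t_\gamma)\log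 \mathrm e},\qquad t_\gamma=-\gamma\,W_{-1}\!\left(-\tfrac1\gamma \mathrm e^{-1/\gamma}\right),$$ where $W_{-1}$ is the secondary real branch of the Lambert $W$ function (the inverse of $w\mapsto w\mathrm e^w$ on $(-\infty,-1]$). Then $$\mathcal I_\omega(P\|Q)\le\begin{cases}\omega-\tfrac12+\sqrt{\tfrac14-\dfrac{\omega(1-\omega)}{1+\omega\,\chi^2(P\|Q)}},&\omega\in(0,\tfrac12],\\[2mm]\tfrac12-\omega+\sqrt{\tfrac14-\dfrac{\omega(1-\omega)}{1+\omega\,\chi^2(Q\|P)}},&\omega\in(\tfrac12,1),\end{cases}$$ and moreover 1) $$\mathcal I_\omega(P\|Q)\le\begin{cases}\omega\,c_{\frac{1-\omega}{\omega}}\,D(P\|Q),&\omega\in(0,\tfrac12),\\[1mm]\sqrt{\tfrac1{8\log \mathrm e}\,\min\{D(P\|Q),D(Q\|P)\}},&\omega=\tfrac12,\\[1mm](1-\omega)\,c_{\frac{\omega}{1-\omega}}\,D(Q\|P),&\omega\in(\tfrac12,1);\end{cases}$$ 2) $$\mathcal I_\omega(P\|Q)\le\begin{cases}\omega-\tfrac12+\sqrt{\tfrac14-\omega(1-\omega)\exp(-D(P\|Q))},&\omega\in(0,\tfrac12],\\[1mm]\tfrac12-\omega+\sqrt{\tfrac14-\omega(1-\omega)\exp(-D(Q\|P))},&\omega\in(\tfrac12,1).\end{cases}$$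 -/

import Mathlib

open MeasureTheory InformationTheory Filter Topology
open scoped ENNReal

noncomputable section

namespace DeGroot

/-- The value at `0` of a function on `(0, ∞)`: `f(0) := lim_{t ↓ 0} f(t)`, an extended real. -/
def limZero (f : ℝ → ℝ) : EReal :=
  limUnder (𝓝[>] (0 : ℝ)) (fun t => ((f t : ℝ) : EReal))

/-- `lim_{u → ∞} f(u) / u`, an extended real. -/
def limSlope (f : ℝ → ℝ) : EReal :=
  limUnder (atTop : Filter ℝ) (fun u => ((f u / u : ℝ) : EReal))

/-- The integrand `q f(p / q)` for `p, q ≥ 0`, with the usual conventions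
`0 f(0 / 0) = 0`, `0 f(a / 0) = a lim_{u → ∞} f(u) / u` and `f(0) = lim_{t ↓ 0} f(t)`. -/
def fDivIntegrand (f : ℝ → ℝ) (p q : ℝ) : EReal :=
  if q = 0 then
    (if p = 0 then 0 else (p : EReal) * limSlope f)
  else
    (if p = 0 then (q : EReal) * limZero f else ((q * f (p / q) : ℝ) : EReal))

/-- The integral of an extended-real function: integral of its positive part minus integral of
its negative part. -/
def extIntegral {α : Type*} [MeasurableSpace α] (μ : Measure α) (g : α → EReal) : EReal :=
  ((∫⁻ a, (g a).toENNReal ∂μ : ℝ≥0∞) : EReal) - ((∫⁻ a, (-(g a)).toENNReal ∂μ : ℝ≥0∞) : EReal)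

/-- The `f`-divergence `D_f(P‖Q) = ∫ q f(p / q) dμ`, where `p`, `q` are the densities of `P`, `Q`
with respect to the dominating measure `μ = P + Q`. -/
def fDiv {α : Type*} [MeasurableSpace α] (f : ℝ → ℝ) (P Q : Measure α) : EReal :=
  extIntegral (P + Q) (fun a =>
    fDivIntegrand f (P.rnDeriv (P + Q) a).toReal (Q.rnDeriv (P + Q) a).toReal)

/-- The chi-squared divergence `χ²(P‖Q)`, the `f`-divergence of `f(t) = (t - 1)²`. -/
def chiSq {α : Type*} [MeasurableSpace α] (P Q : Measure α) : EReal :=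
  fDiv (fun t => (t - 1) ^ 2) P Q

/-- The DeGroot statistical information `I_ω(P‖Q)`, the `f`-divergence of
`φ_ω(t) = min {ω, 1 - ω} - min {ω t, 1 - ω}`. -/
def statInfo {α : Type*} [MeasurableSpace α] (ω : ℝ) (P Q : Measure α) : EReal :=
  fDiv (fun t => min ω (1 - ω) - min (ω * t) (1 - ω)) P Q

/-- The relative entropy `D(P‖Q)` of probability measures with logarithms to the base `b`:
the relative entropy in nats divided by `ln b`. -/
def relEntropy {α : Type*} [MeasurableSpace α] (b : ℝ) (P Q : Measure α) : ℝ≥0∞ :=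
  klDiv P Q / ENNReal.ofReal (Real.log b)

/-- `b ^ (-D)` for `D ∈ [0, ∞]`, with `b ^ (-∞) = 0`. -/
def expNeg (b : ℝ) (D : ℝ≥0∞) : ℝ :=
  if D = ⊤ then 0 else b ^ (-D.toReal)

/-- The secondary real branch `W₋₁ : [-1/e, 0) → (-∞, -1]` of the Lambert `W` function,
the inverse of `w ↦ w eʷ` on `(-∞, -1]`. -/
def lambertWNegOne (z : ℝ) : ℝ :=
  Function.invFunOn (fun w : ℝ => w * Real.exp w) (Set.Iic (-1)) z

/-- `t_γ = -γ W₋₁(-(1/γ) e^{-1/γ})`. -/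
def tGamma (γ : ℝ) : ℝ :=
  -γ * lambertWNegOne (-(1 / γ) * Real.exp (-(1 / γ)))

/-- `c_γ = (t_γ - γ) / (t_γ log t_γ + (1 - t_γ) log e)`, with logarithms to the base `b`. -/
def cGamma (b γ : ℝ) : ℝ :=
  (tGamma γ - γ) /
    (tGamma γ * Real.logb b (tGamma γ) + (1 - tGamma γ) * Real.logb b (Real.exp 1))

end DeGroot

end

/-! ### Divergences as integrals and the Bayes error -/

namespace DeGroot

/-! With `E = ∫ min (ω p) ((1 - ω) q)` the Bayes error, the statistical information is `min ω (1 -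
ω) - E`, so every claim is a lower bound on `E`. Exchanging the measures reduces `ω > 1/2` to `ω <
1/2`.

Put `r = p / q`, `x = ω r + 1 - ω`, and let `η` be the posterior probability. Since `η (1 - η) = m
(1 - m)` with `m = min η (1 - η)` of mean `E`, Jensen gives `E - E² ≥ 𝔼[η (1 - η)] = ω (1 - ω) 𝔼_P[1
/ x]`. Jensen for `1 / x` with `𝔼_P[x] = 1 + ω χ²` gives the chi-squared bound; Jensen for `exp
(-log x)` with `𝔼_P[log x] ≤ D` gives the exponential one. The linear bound is a tangent line of
`klFun`, and the square-root bound is Pinsker's inequality.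

Each use of Jensen or Cauchy–Schwarz is replaced by a tangent inequality, pointwise in `r` and
affine in `min (ω r) (1 - ω)`, `r` and `g r`, with the point of tangency set to the final value.
`HasDivergence.affine_le` integrates such inequalities. An infinite divergence leaves only trivial
bounds. -/

lemma limZero_eq {f : ℝ → ℝ} {c : ℝ} (h : Tendsto f (𝓝[>] 0) (𝓝 c)) : limZero f = (c : EReal) :=
  (continuous_coe_real_ereal.continuousAt.tendsto.comp h).limUnder_eq

lemma limSlope_eq {f : ℝ → ℝ} {c : ℝ} (h : Tendsto (fun u => f u / u) atTop (𝓝 c)) :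
    limSlope f = (c : EReal) :=
  (continuous_coe_real_ereal.continuousAt.tendsto.comp h).limUnder_eq

lemma limSlope_eq_top {f : ℝ → ℝ} (h : Tendsto (fun u => f u / u) atTop atTop) :
    limSlope f = ⊤ :=
  (EReal.tendsto_coe_nhds_top_iff.2 h).limUnder_eq

variable {α : Type*} [MeasurableSpace α]

lemma coe_ennreal_eq_coe_toReal {x : ℝ≥0∞} (hx : x ≠ ⊤) : (x : EReal) = (x.toReal : EReal) := by
  lift x to NNReal using hx
  rfl

lemma extIntegral_coe {μ : Measure α} {f : α → ℝ} (hf : Integrable f μ) :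
    extIntegral μ (fun a => (f a : EReal)) = ((∫ a, f a ∂μ : ℝ) : EReal) := by
  have h1 : (∫⁻ a, ENNReal.ofReal (f a) ∂μ) ≠ ⊤ := hf.lintegral_lt_top.ne
  have h2 : (∫⁻ a, ENNReal.ofReal (-f a) ∂μ) ≠ ⊤ := hf.neg.lintegral_lt_top.ne
  rw [integral_eq_lintegral_pos_part_sub_lintegral_neg_part hf, EReal.coe_sub]
  simp only [extIntegral, EReal.real_coe_toENNReal, ← EReal.coe_neg]
  rw [coe_ennreal_eq_coe_toReal h1, coe_ennreal_eq_coe_toReal h2]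

lemma extIntegral_of_nonneg {μ : Measure α} {g : α → EReal} (hg : ∀ a, 0 ≤ g a) :
    extIntegral μ g = ((∫⁻ a, (g a).toENNReal ∂μ : ℝ≥0∞) : EReal) := by
  have h : ∀ a, (-(g a)).toENNReal = 0 := fun a =>
    EReal.toENNReal_of_nonpos (by simpa using hg a)
  simp [extIntegral, h]

/-- The density of `P` with respect to `P + Q`. -/
noncomputable def densLeft (P Q : Measure α) (a : α) : ℝ := (P.rnDeriv (P + Q) a).toReal

/-- The density of `Q` with respect to `P + Q`. -/
noncomputable def densRight (P Q : Measure α) (a : α) : ℝ := (Q.rnDeriv (P + Q) a).toReal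

/-- The Bayes error probability for the prior `(ω, 1 - ω)`. -/
noncomputable def bayesError (ω : ℝ) (P Q : Measure α) : ℝ :=
  ∫ a, min (ω * densLeft P Q a) ((1 - ω) * densRight P Q a) ∂(P + Q)

variable {P Q : Measure α}

lemma densLeft_nonneg (a : α) : 0 ≤ densLeft P Q a := ENNReal.toReal_nonneg

lemma densRight_nonneg (a : α) : 0 ≤ densRight P Q a := ENNReal.toReal_nonneg

lemma measurable_densLeft : Measurable (densLeft P Q) :=
  (Measure.measurable_rnDeriv _ _).ennreal_toReal

lemma measurable_densRight : Measurable (densRight P Q) :=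
  (Measure.measurable_rnDeriv _ _).ennreal_toReal

lemma integrable_densLeft [IsFiniteMeasure P] : Integrable (densLeft P Q) (P + Q) :=
  Measure.integrable_toReal_rnDeriv

lemma integrable_densRight [IsFiniteMeasure Q] : Integrable (densRight P Q) (P + Q) :=
  Measure.integrable_toReal_rnDeriv

lemma integral_densLeft [IsProbabilityMeasure P] [IsProbabilityMeasure Q] :
    ∫ a, densLeft P Q a ∂(P + Q) = 1 := by
  unfold densLeft
  rw [Measure.integral_toReal_rnDeriv (Measure.AbsolutelyContinuous.rfl.add_right _)]
  simp

lemma integral_densRight [IsProbabilityMeasure P] [IsProbabilityMeasure Q] :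
    ∫ a, densRight P Q a ∂(P + Q) = 1 := by
  unfold densRight
  rw [Measure.integral_toReal_rnDeriv (Measure.AbsolutelyContinuous.rfl.add_right' _)]
  simp

lemma integrable_min_dens [IsFiniteMeasure P] [IsFiniteMeasure Q] (ω : ℝ) :
    Integrable (fun a => min (ω * densLeft P Q a) ((1 - ω) * densRight P Q a)) (P + Q) :=
  (integrable_densLeft.const_mul ω).inf (integrable_densRight.const_mul (1 - ω))

lemma bayesError_nonneg {ω : ℝ} (h0 : 0 ≤ ω) (h1 : ω ≤ 1) : 0 ≤ bayesError ω P Q :=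
  integral_nonneg fun a => le_min (mul_nonneg h0 (densLeft_nonneg a))
    (mul_nonneg (by linarith) (densRight_nonneg a))

/-- The slope at infinity is `0` and the limit at `0` is `min ω (1 - ω)`, so the boundary
conventions agree with the homogeneous formula. -/
lemma fDivIntegrand_statInfo {ω : ℝ} (h0 : 0 < ω) (h1 : ω < 1) {p q : ℝ} (hp : 0 ≤ p)
    (hq : 0 ≤ q) :
    fDivIntegrand (fun t => min ω (1 - ω) - min (ω * t) (1 - ω)) p q =
      ((min ω (1 - ω) * q - min (ω * p) ((1 - ω) * q) : ℝ) : EReal) := by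
  have hz : limZero (fun t => min ω (1 - ω) - min (ω * t) (1 - ω)) =
      ((min ω (1 - ω) : ℝ) : EReal) := by
    apply limZero_eq
    have : Continuous fun t : ℝ => min ω (1 - ω) - min (ω * t) (1 - ω) := by fun_prop
    have h := (this.tendsto 0).mono_left (nhdsWithin_le_nhds (s := Set.Ioi 0))
    simpa [min_eq_left (by linarith : (0 : ℝ) ≤ 1 - ω)] using h
  have hs : limSlope (fun t => min ω (1 - ω) - min (ω * t) (1 - ω)) = ((0 : ℝ) : EReal) := by
    apply limSlope_eq
    have h : Tendsto (fun u : ℝ => (min ω (1 - ω) - (1 - ω)) / u) atTop (𝓝 0) :=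
      tendsto_const_nhds.div_atTop tendsto_id
    refine h.congr' ?_
    filter_upwards [eventually_ge_atTop ((1 - ω) / ω)] with u hu
    rw [div_le_iff₀ h0] at hu
    rw [min_eq_right (by linarith : 1 - ω ≤ ω * u)]
  unfold fDivIntegrand
  rcases hq.eq_or_lt with rfl | hq'
  · rw [if_pos rfl, hs]
    simp [mul_nonneg h0.le hp]
  rw [if_neg hq'.ne', hz]
  split_ifs with hp0
  · subst hp0
    rw [← EReal.coe_mul]
    rw [mul_zero, min_eq_left (mul_nonneg (by linarith : (0 : ℝ) ≤ 1 - ω) hq), sub_zero, mul_comm]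
  · have e : q * min (ω * (p / q)) (1 - ω) = min (ω * p) ((1 - ω) * q) := by
      rw [mul_min_of_nonneg _ _ hq]
      congr 1
      · field_simp
      · ring
    rw [mul_sub, e, mul_comm q]

theorem statInfo_eq [IsProbabilityMeasure P] [IsProbabilityMeasure Q] {ω : ℝ} (h0 : 0 < ω)
    (h1 : ω < 1) : statInfo ω P Q = ((min ω (1 - ω) - bayesError ω P Q : ℝ) : EReal) := by
  have h : ∀ a, fDivIntegrand (fun t => min ω (1 - ω) - min (ω * t) (1 - ω))
      (P.rnDeriv (P + Q) a).toReal (Q.rnDeriv (P + Q) a).toReal =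
      ((min ω (1 - ω) * densRight P Q a -
        min (ω * densLeft P Q a) ((1 - ω) * densRight P Q a) : ℝ) : EReal) := fun a =>
    fDivIntegrand_statInfo h0 h1 (densLeft_nonneg a) (densRight_nonneg a)
  have hi := (integrable_densRight (P := P) (Q := Q)).const_mul (min ω (1 - ω))
  simp only [statInfo, fDiv, h]
  rw [extIntegral_coe (by exact hi.sub (integrable_min_dens ω)), integral_sub hi (integrable_min_dens ω),
    integral_const_mul, integral_densRight, mul_one, bayesError]

lemma bayesError_symm (ω : ℝ) : bayesError (1 - ω) Q P = bayesError ω P Q := by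
  simp only [bayesError, densLeft, densRight, add_comm Q P, sub_sub_cancel, min_comm]

theorem statInfo_symm [IsProbabilityMeasure P] [IsProbabilityMeasure Q] {ω : ℝ} (h0 : 0 < ω)
    (h1 : ω < 1) : statInfo ω P Q = statInfo (1 - ω) Q P := by
  rw [statInfo_eq h0 h1, statInfo_eq (by linarith) (by linarith), bayesError_symm,
    sub_sub_cancel, min_comm]

/-- `P ≪ Q` and `q g(p / q)` is integrable with integral `d`. -/
def HasDivergence (g : ℝ → ℝ) (P Q : Measure α) (d : ℝ) : Prop :=
  ∃ h : α → ℝ, Integrable h (P + Q) ∧ ∫ a, h a ∂(P + Q) = d ∧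
    ∀ᵐ a ∂(P + Q), ∃ r : ℝ, 0 ≤ r ∧ densLeft P Q a = r * densRight P Q a ∧
      h a = densRight P Q a * g r

/-- Multiply the pointwise inequality by `q` and integrate; both densities have integral `1`. -/
theorem HasDivergence.affine_le [IsProbabilityMeasure P] [IsProbabilityMeasure Q]
    {g : ℝ → ℝ} {d : ℝ} (hd : HasDivergence g P Q d) {ω A B C K : ℝ}
    (h : ∀ r, 0 ≤ r → A * min (ω * r) (1 - ω) + B * r + C ≤ K * g r) :
    A * bayesError ω P Q + B + C ≤ K * d := by
  obtain ⟨k, hk, rfl, hae⟩ := hd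
  have h1 := (integrable_min_dens (P := P) (Q := Q) ω).const_mul A
  have h2 := (integrable_densLeft (P := P) (Q := Q)).const_mul B
  have h3 := (integrable_densRight (P := P) (Q := Q)).const_mul C
  have e : ∫ a, (A * min (ω * densLeft P Q a) ((1 - ω) * densRight P Q a) +
      B * densLeft P Q a + C * densRight P Q a) ∂(P + Q) = A * bayesError ω P Q + B + C := by
    rw [integral_add (by exact h1.add h2) h3, integral_add h1 h2]
    simp only [integral_const_mul, integral_densLeft, integral_densRight, mul_one, bayesError]
  rw [← e, ← integral_const_mul]
  refine integral_mono_ae ((h1.add h2).add h3) (hk.const_mul K) ?_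
  filter_upwards [hae] with a ⟨r, hr, hp, hh⟩
  have hq := densRight_nonneg (P := P) (Q := Q) a
  have := mul_le_mul_of_nonneg_left (h r hr) hq
  simp only [hh, hp]
  have e1 : min (ω * (r * densRight P Q a)) ((1 - ω) * densRight P Q a) =
      densRight P Q a * min (ω * r) (1 - ω) := by
    rw [mul_min_of_nonneg _ _ hq]; congr 1 <;> ring
  rw [e1]
  linarith

theorem hasDivergence_klFun [IsProbabilityMeasure P] [IsProbabilityMeasure Q]
    (h : klDiv P Q ≠ ⊤) : HasDivergence klFun P Q (klDiv P Q).toReal := by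
  obtain ⟨hac, hint⟩ := klDiv_ne_top_iff.1 h
  have hQ : Q ≪ P + Q := Measure.AbsolutelyContinuous.rfl.add_right' _
  have hi := (integrable_klFun_rnDeriv_iff hac).2 hint
  refine ⟨fun a => densRight P Q a * klFun (P.rnDeriv Q a).toReal, ?_, ?_, ?_⟩
  · exact (integrable_rnDeriv_smul_iff hQ).2 hi
  · rw [toReal_klDiv_eq_integral_klFun hac]
    exact integral_rnDeriv_smul hQ
  · filter_upwards [Measure.rnDeriv_mul_rnDeriv (κ := P + Q) hac] with a ha
    refine ⟨_, ENNReal.toReal_nonneg, ?_, rfl⟩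
    rw [densLeft, ← ha, Pi.mul_apply, ENNReal.toReal_mul, densRight]

lemma fDivIntegrand_chiSq {p q : ℝ} (hp : 0 ≤ p) :
    fDivIntegrand (fun t => (t - 1) ^ 2) p q =
      if q = 0 then (if p = 0 then 0 else ⊤) else ((q * (p / q - 1) ^ 2 : ℝ) : EReal) := by
  have hz : limZero (fun t => (t - 1) ^ 2) = ((1 : ℝ) : EReal) := by
    apply limZero_eq
    have : Continuous fun t : ℝ => (t - 1) ^ 2 := by fun_prop
    simpa using (this.tendsto 0).mono_left (nhdsWithin_le_nhds (s := Set.Ioi 0))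
  have hs : limSlope (fun t => (t - 1) ^ 2) = ⊤ := by
    apply limSlope_eq_top
    refine tendsto_atTop_mono' _ ?_ (tendsto_atTop_add_const_right _ (-2 : ℝ) tendsto_id)
    filter_upwards [eventually_gt_atTop 0] with u hu
    rw [le_div_iff₀ hu]
    simp only [id]
    nlinarith
  unfold fDivIntegrand
  split_ifs with h1 h2 h2
  · rfl
  · rw [hs, EReal.coe_mul_top_of_pos (hp.lt_of_ne' h2)]
  · rw [hz, h2, ← EReal.coe_mul]
    simp
  · rfl

/-- The integrand is `⊤` where `q = 0 < p`, so a finite integral makes that set null and `p / q`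
serves as the ratio almost everywhere. -/
theorem chiSq_eq_top_or_hasDivergence [IsProbabilityMeasure P] [IsProbabilityMeasure Q] :
    chiSq P Q = ⊤ ∨ ∃ d : ℝ, 0 ≤ d ∧ chiSq P Q = d ∧
      HasDivergence (fun t => (t - 1) ^ 2) P Q d := by
  set g : α → EReal := fun a => if densRight P Q a = 0 then
    (if densLeft P Q a = 0 then 0 else ⊤)
    else ((densRight P Q a * (densLeft P Q a / densRight P Q a - 1) ^ 2 : ℝ) : EReal) with hg
  have hg0 : ∀ a, 0 ≤ g a := by
    intro a
    have := densRight_nonneg (P := P) (Q := Q) a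
    simp only [hg]
    split_ifs
    · exact le_rfl
    · exact le_top
    · exact EReal.coe_nonneg.2 (by positivity)
  have hgm : Measurable g := by
    have hp := measurable_densLeft (P := P) (Q := Q)
    have hq := measurable_densRight (P := P) (Q := Q)
    refine Measurable.ite (hq (measurableSet_singleton 0)) (Measurable.ite
      (hp (measurableSet_singleton 0)) measurable_const measurable_const) ?_
    exact measurable_coe_real_ereal.comp (hq.mul (((hp.div hq).sub_const 1).pow_const 2))
  have hgm' : Measurable fun a => (g a).toENNReal := measurable_ereal_toENNReal.comp hgm
  have e : chiSq P Q = ((∫⁻ a, (g a).toENNReal ∂(P + Q) : ℝ≥0∞) : EReal) := by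
    rw [← extIntegral_of_nonneg hg0]
    unfold chiSq fDiv
    congr 1
    ext1 a
    exact fDivIntegrand_chiSq (densLeft_nonneg a)
  by_cases ht : (∫⁻ a, (g a).toENNReal ∂(P + Q)) = ⊤
  · left; rw [e, ht, EReal.coe_ennreal_top]
  right
  have hlt := ae_lt_top hgm' ht
  refine ⟨_, ENNReal.toReal_nonneg, e.trans (coe_ennreal_eq_coe_toReal ht),
    fun a => (g a).toENNReal.toReal, integrable_toReal_of_lintegral_ne_top hgm'.aemeasurable ht,
    integral_toReal hgm'.aemeasurable hlt, ?_⟩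
  filter_upwards [hlt] with a ha
  have hp := densLeft_nonneg (P := P) (Q := Q) a
  have hq := densRight_nonneg (P := P) (Q := Q) a
  simp only [hg] at ha ⊢
  split_ifs at ha ⊢ with h1 h2
  · exact ⟨0, le_rfl, by simp [h2], by simp [h1]⟩
  · simp at ha
  · refine ⟨_, div_nonneg hp hq, (div_mul_cancel₀ _ h1).symm, ?_⟩
    rw [EReal.real_coe_toENNReal, ENNReal.toReal_ofReal (by positivity)]

end DeGroot

/-! ### Pointwise inequalities and the Lambert function -/

namespace DeGroot

/-- The supporting line of `klFun` at `τ`. -/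
lemma klFun_tangent_le {τ t : ℝ} (hτ : 0 < τ) (ht : 0 ≤ t) :
    Real.log τ * t + (1 - τ) ≤ klFun t := by
  rcases ht.eq_or_lt with rfl | ht
  · simp [klFun_zero, hτ.le]
  have h := Real.log_le_sub_one_of_pos (div_pos hτ ht)
  rw [Real.log_div hτ.ne' ht.ne'] at h
  have h2 := mul_le_mul_of_nonneg_left h ht.le
  have h3 : t * (τ / t - 1) = τ - t := by field_simp
  rw [klFun_apply]
  linarith

/-- Pointwise form of Pinsker's inequality. `F = G'` is increasing and vanishes at `1`, so `G` has
its minimum `0` there. -/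
lemma three_mul_sq_le_klFun {t : ℝ} (ht : 0 ≤ t) :
    3 * (t - 1) ^ 2 ≤ 2 * (t + 2) * klFun t := by
  -- `G` is the difference divided by `2 (t + 2)`, with derivative `F`.
  set F : ℝ → ℝ := fun t => Real.log t - 3 / 2 * ((t - 1) * (t + 5) / (t + 2) ^ 2) with hF
  set G : ℝ → ℝ := fun t => klFun t - 3 / 2 * ((t - 1) ^ 2 / (t + 2)) with hG
  have dF : ∀ x, 0 < x → HasDerivAt F (1 / x - 27 / (x + 2) ^ 3) x := by
    intro x hx
    have h1 := (((hasDerivAt_id x).sub_const 1).mul ((hasDerivAt_id x).add_const 5)).div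
      (((hasDerivAt_id x).add_const 2).pow 2) (by simp; positivity)
    have := (Real.hasDerivAt_log hx.ne').sub (h1.const_mul (3 / 2))
    refine this.congr_deriv ?_
    simp
    field_simp
    ring
  have dG : ∀ x, 0 < x → HasDerivAt G (F x) x := by
    intro x hx
    have h1 := (((hasDerivAt_id x).sub_const 1).pow 2).div
      ((hasDerivAt_id x).add_const 2) (by simp; positivity)
    have := (hasDerivAt_klFun hx.ne').sub (h1.const_mul (3 / 2))
    refine this.congr_deriv ?_
    simp [hF]
    field_simp
    ring
  have mF : MonotoneOn F (Set.Ioi 0) := by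
    refine monotoneOn_of_hasDerivWithinAt_nonneg (convex_Ioi 0)
      (fun x hx => (dF x hx).continuousAt.continuousWithinAt)
      (fun x hx => (dF x (by simpa using hx)).hasDerivWithinAt) ?_
    intro x hx
    have hx : 0 < x := by simpa using hx
    rw [sub_nonneg, div_le_div_iff₀ (by positivity) hx]
    -- `(x + 2)³ - 27 x = (x - 1)² (x + 8)`.
    nlinarith [mul_nonneg (sq_nonneg (x - 1)) (by linarith : 0 ≤ x + 8)]
  have F1 : F 1 = 0 := by simp [hF]
  have G1 : G 1 = 0 := by simp [hG, klFun_one]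
  have cG : ContinuousOn G (Set.Ici 0) := by
    refine continuous_klFun.continuousOn.sub (ContinuousOn.mul continuousOn_const
      (ContinuousOn.div (by fun_prop) (by fun_prop) ?_))
    intro x hx
    have : (0 : ℝ) ≤ x := hx
    positivity
  have hGt : 0 ≤ G t := by
    rw [← G1]
    rcases le_total t 1 with h | h
    · refine antitoneOn_of_hasDerivWithinAt_nonpos (convex_Icc 0 1)
        (cG.mono Set.Icc_subset_Ici_self)
        (fun x hx => (dG x (by simp at hx; exact hx.1)).hasDerivWithinAt) ?_ ⟨ht, h⟩
        ⟨zero_le_one, le_rfl⟩ h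
      intro x hx
      rw [interior_Icc] at hx
      rw [← F1]
      exact mF hx.1 (by simp) hx.2.le
    · refine monotoneOn_of_hasDerivWithinAt_nonneg (convex_Ici 1)
        (cG.mono (Set.Ici_subset_Ici.2 zero_le_one))
        (fun x hx => (dG x ?_).hasDerivWithinAt) ?_ (Set.mem_Ici.2 le_rfl) h h
      · simp at hx; linarith
      intro x hx
      rw [interior_Ici] at hx
      rw [← F1]
      exact mF (by simp) (Set.mem_Ioi.2 (zero_lt_one.trans (Set.mem_Ioi.1 hx))) (le_of_lt hx)
  have h2 : 0 < t + 2 := by linarith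
  have h3 : 2 * (t + 2) * G t = 2 * (t + 2) * klFun t - 3 * (t - 1) ^ 2 := by
    simp only [hG]; field_simp
  have := mul_nonneg (by linarith : 0 ≤ 2 * (t + 2)) hGt
  linarith

/-- The tangent form of the previous bound, affine in `min t 1` and `t`. -/
lemma pinsker_pointwise {t : ℝ} (ht : 0 ≤ t) (s : ℝ) :
    3 / 2 * (2 * s * (t + 1 - 2 * min t 1) - s ^ 2 * (t + 2)) ≤ klFun t := by
  have h := three_mul_sq_le_klFun ht
  have h2 : 0 < t + 2 := by linarith
  have habs : t + 1 - 2 * min t 1 = |t - 1| := by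
    rcases le_total t 1 with h | h
    · rw [min_eq_left h, abs_of_nonpos (by linarith)]; ring
    · rw [min_eq_right h, abs_of_nonneg (by linarith)]; ring
  rw [habs]
  have h3 : 0 ≤ (|t - 1| - s * (t + 2)) ^ 2 := sq_nonneg _
  refine le_of_mul_le_mul_left ?_ (by linarith : 0 < 2 * (t + 2))
  refine le_trans ?_ h
  rw [← sq_abs (t - 1)]
  nlinarith

/-- A tangent form of `B (1 - B) ≥ 𝔼[η (1 - η)]`, with `η` the posterior probability. -/
lemma posterior_le {ω : ℝ} (h0 : 0 < ω) (h1 : ω < 1) (B : ℝ) {r : ℝ} (hr : 0 ≤ r) :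
    ω * (1 - ω) * (r / (ω * r + (1 - ω))) ≤
      (1 - 2 * B) * min (ω * r) (1 - ω) + B ^ 2 * (ω * r + (1 - ω)) := by
  have hs : 0 < ω * r + (1 - ω) := by nlinarith [mul_nonneg h0.le hr]
  set m := min (ω * r) (1 - ω) with hm
  have hprod : ω * (1 - ω) * r = m * (ω * r + (1 - ω) - m) := by
    rcases le_total (ω * r) (1 - ω) with h | h
    · rw [hm, min_eq_left h]; ring
    · rw [hm, min_eq_right h]; ring
  rw [← mul_div_assoc, hprod, div_le_iff₀ hs]
  -- With `x = ω r + 1 - ω`, the difference of the two sides is `(m - B x)²`.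
  nlinarith [sq_nonneg (m - B * (ω * r + (1 - ω)))]

/-- The convex function `1 / x` lies above its tangent at `s`; this is multiplied by `r`. -/
lemma chiSq_pointwise {ω : ℝ} (h0 : 0 < ω) (h1 : ω < 1) {s : ℝ} (hs : 0 < s) {r : ℝ}
    (hr : 0 ≤ r) :
    r * (2 / s - (ω * r + (1 - ω)) / s ^ 2) ≤ r / (ω * r + (1 - ω)) := by
  have hx : 0 < ω * r + (1 - ω) := by nlinarith [mul_nonneg h0.le hr]
  set x := ω * r + (1 - ω)
  rw [div_eq_mul_inv r]
  refine mul_le_mul_of_nonneg_left ?_ hr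
  have : x⁻¹ - (2 / s - x / s ^ 2) = (x - s) ^ 2 / (x * s ^ 2) := by field_simp; ring
  rw [← sub_nonneg, this]
  positivity

/-- `exp (-y)` lies above its tangent at `d`, taken at `y = log x`. Then `r log x ≤ r log r + x -
r`, whose correction `x - r = (1 - ω) (1 - r)` integrates to `0` against `q`. -/
lemma exp_pointwise {ω : ℝ} (h0 : 0 < ω) (h1 : ω < 1) (d : ℝ) {r : ℝ} (hr : 0 ≤ r) :
    Real.exp (-d) * ((1 + d) * r + ω * (1 - r) - klFun r) ≤ r / (ω * r + (1 - ω)) := by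
  have hx : 0 < ω * r + (1 - ω) := by nlinarith [mul_nonneg h0.le hr]
  rcases hr.eq_or_lt with rfl | hr
  · simp only [klFun_zero, zero_div]
    exact mul_nonpos_of_nonneg_of_nonpos (Real.exp_pos _).le (by linarith)
  set x := ω * r + (1 - ω) with hxd
  have h2 : Real.exp (-d) * (1 + d - Real.log x) ≤ x⁻¹ := by
    have := Real.add_one_le_exp (d - Real.log x)
    calc Real.exp (-d) * (1 + d - Real.log x)
        ≤ Real.exp (-d) * Real.exp (d - Real.log x) := by gcongr; linarith
      _ = x⁻¹ := by
        rw [← Real.exp_add, show -d + (d - Real.log x) = -Real.log x by ring, Real.exp_neg,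
          Real.exp_log hx]
  have h3 : r * Real.log x ≤ r * Real.log r + (1 - ω) * (1 - r) := by
    have h := Real.log_le_sub_one_of_pos (div_pos hx hr)
    rw [Real.log_div hx.ne' hr.ne'] at h
    have h4 := mul_le_mul_of_nonneg_left h hr.le
    have h5 : r * (x / r - 1) = x - r := by field_simp
    have h6 : x - r = (1 - ω) * (1 - r) := by rw [hxd]; ring
    linarith
  calc _ ≤ Real.exp (-d) * (r * (1 + d - Real.log x)) := by
        gcongr
        rw [klFun_apply]
        linarith
    _ = r * (Real.exp (-d) * (1 + d - Real.log x)) := by ring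
    _ ≤ r * x⁻¹ := by gcongr
    _ = r / x := (div_eq_mul_inv _ _).symm

/-- The point `-u` lies on the principal branch. A preimage in `(-∞, -1]` exists by the intermediate
value theorem, as `v e^{-v}` falls from `1/e` at `1` to `0` at infinity; it is not `-1` because `u
e^{-u} < 1/e`. -/
lemma lambertWNegOne_spec {u : ℝ} (h0 : 0 < u) (h1 : u < 1) :
    lambertWNegOne (-u * Real.exp (-u)) < -1 ∧
      lambertWNegOne (-u * Real.exp (-u)) * Real.exp (lambertWNegOne (-u * Real.exp (-u))) =
        -u * Real.exp (-u) := by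
  have hneg : ∀ v : ℝ, v * Real.exp (-v) ≤ Real.exp (-1) := by
    intro v
    have := Real.add_one_le_exp (v - 1)
    calc v * Real.exp (-v) ≤ Real.exp (v - 1) * Real.exp (-v) := by gcongr; linarith
      _ = Real.exp (-1) := by rw [← Real.exp_add]; ring_nf
  have hlt : u * Real.exp (-u) < Real.exp (-1) := by
    have := Real.add_one_lt_exp (by linarith : u - 1 ≠ 0)
    calc u * Real.exp (-u) < Real.exp (u - 1) * Real.exp (-u) := by gcongr; linarith
      _ = Real.exp (-1) := by rw [← Real.exp_add]; ring_nf
  have hpos : 0 < u * Real.exp (-u) := by positivity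
  have hex : ∃ w ∈ Set.Iic (-1 : ℝ), (fun w : ℝ => w * Real.exp w) w = -u * Real.exp (-u) := by
    have ht : Tendsto (fun v : ℝ => v * Real.exp (-v)) atTop (𝓝 0) := by
      simpa using Real.tendsto_pow_mul_exp_neg_atTop_nhds_zero 1
    obtain ⟨v, hv1, hv⟩ := ((eventually_ge_atTop (1 : ℝ)).and
      (ht.eventually (gt_mem_nhds hpos))).exists
    have hc : ContinuousOn (fun v : ℝ => v * Real.exp (-v)) (Set.Icc 1 v) := by fun_prop
    obtain ⟨x, hx, hxe⟩ := intermediate_value_Icc' hv1 hc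
      ⟨hv.le, by simpa using hlt.le⟩
    refine ⟨-x, by simpa using hx.1, ?_⟩
    simp only at hxe ⊢
    linarith
  have hmem : lambertWNegOne (-u * Real.exp (-u)) ∈ Set.Iic (-1 : ℝ) :=
    Function.invFunOn_mem hex
  have heq := Function.invFunOn_eq hex
  refine ⟨lt_of_le_of_ne hmem fun h => ?_, heq⟩
  change lambertWNegOne (-u * Real.exp (-u)) * Real.exp (lambertWNegOne (-u * Real.exp (-u))) =
    -u * Real.exp (-u) at heq
  rw [h] at heq
  linarith

/-- The equation says that the tangent to `klFun` at `t_γ` vanishes at `γ`. -/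
lemma tGamma_spec {γ : ℝ} (hγ : 1 < γ) :
    γ < tGamma γ ∧ tGamma γ - 1 = γ * Real.log (tGamma γ) := by
  have hγ0 : 0 < γ := by linarith
  obtain ⟨h1, h2⟩ := lambertWNegOne_spec (one_div_pos.2 hγ0) ((div_lt_one hγ0).2 hγ)
  unfold tGamma
  set w := lambertWNegOne (-(1 / γ) * Real.exp (-(1 / γ)))
  have hlt : γ < -γ * w := by nlinarith
  refine ⟨hlt, ?_⟩
  have e : -γ * w = Real.exp (-w - 1 / γ) := by
    have h3 : (-γ * w) * Real.exp w = Real.exp (-(1 / γ)) := by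
      rw [mul_assoc, h2]; field_simp
    rw [show -w - 1 / γ = -(1 / γ) - w by ring, Real.exp_sub, ← h3]
    field_simp
  have h4 : Real.log (-γ * w) = -w - 1 / γ := by rw [e, Real.log_exp]
  rw [h4]
  field_simp

lemma cGamma_eq {b γ : ℝ} (hb : 1 < b) (hγ : 1 < γ) :
    cGamma b γ = Real.log b / Real.log (tGamma γ) := by
  obtain ⟨h1, h2⟩ := tGamma_spec hγ
  have hlb : 0 < Real.log b := Real.log_pos hb
  have hlt : 0 < Real.log (tGamma γ) := Real.log_pos (by linarith)
  have hne : tGamma γ - γ ≠ 0 := by linarith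
  have e : tGamma γ * Real.logb b (tGamma γ) + (1 - tGamma γ) * Real.logb b (Real.exp 1) =
      (tGamma γ - γ) * Real.log (tGamma γ) / Real.log b := by
    rw [Real.logb, Real.logb, Real.log_exp]
    field_simp
    linarith
  rw [cGamma, e]
  field_simp

end DeGroot

/-! ### Integrated bounds -/

namespace DeGroot

variable {α : Type*} [MeasurableSpace α] {P Q : Measure α}

theorem relEntropy_eq_top {b : ℝ} (h : klDiv P Q = ⊤) : relEntropy b P Q = ⊤ := by
  rw [relEntropy, h, ENNReal.top_div_of_ne_top ENNReal.ofReal_ne_top]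

theorem relEntropy_eq_ofReal {b : ℝ} (hb : 1 < b) (h : klDiv P Q ≠ ⊤) :
    relEntropy b P Q = ENNReal.ofReal ((klDiv P Q).toReal / Real.log b) := by
  rw [relEntropy, ENNReal.ofReal_div_of_pos (Real.log_pos hb), ENNReal.ofReal_toReal h]

variable [IsProbabilityMeasure P] [IsProbabilityMeasure Q]

theorem HasDivergence.chiSq_bound {ω d : ℝ} (h0 : 0 < ω) (h1 : ω < 1) (hd0 : 0 ≤ d)
    (hd : HasDivergence (fun t => (t - 1) ^ 2) P Q d) :
    ω * (1 - ω) / (1 + ω * d) ≤ bayesError ω P Q - bayesError ω P Q ^ 2 := by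
  have hs : 0 < 1 + ω * d := by positivity
  -- `s` is the mean of `ω r + 1 - ω` under `P`, the optimal point of tangency.
  set s := 1 + ω * d with hsd
  set E := bayesError ω P Q with hE
  have hc : 0 < ω * (1 - ω) := mul_pos h0 (by linarith)
  -- The right side of `posterior_le` with `B = E` integrates to `(1 - 2 E) E + E² = E - E²`.
  have h := hd.affine_le (ω := ω) (A := -(1 - 2 * E))
    (B := ω * (1 - ω) * (2 / s - (1 + ω) / s ^ 2) - E ^ 2 * ω)
    (C := ω * (1 - ω) * (ω / s ^ 2) - E ^ 2 * (1 - ω)) (K := ω * (1 - ω) * (ω / s ^ 2)) ?_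
  · have e : 2 / s - (1 + ω) / s ^ 2 + ω / s ^ 2 - ω / s ^ 2 * d = 1 / s := by
      field_simp
      rw [hsd]
      ring
    have e2 : ω * (1 - ω) / s = ω * (1 - ω) * (1 / s) := by ring
    rw [e2, ← e]
    rw [← hE] at h
    linarith
  · intro r hr
    have h2 := mul_le_mul_of_nonneg_left (chiSq_pointwise h0 h1 hs hr) hc.le
    have h3 := posterior_le h0 h1 E hr
    have e : r * (2 / s - (ω * r + (1 - ω)) / s ^ 2) =
        (2 / s - (1 + ω) / s ^ 2) * r + ω / s ^ 2 - ω / s ^ 2 * (r - 1) ^ 2 := by ring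
    rw [e] at h2
    linarith

theorem HasDivergence.exp_bound {ω d : ℝ} (h0 : 0 < ω) (h1 : ω < 1)
    (hd : HasDivergence klFun P Q d) :
    ω * (1 - ω) * Real.exp (-d) ≤ bayesError ω P Q - bayesError ω P Q ^ 2 := by
  set E := bayesError ω P Q with hE
  have hc : 0 < ω * (1 - ω) := mul_pos h0 (by linarith)
  set c := ω * (1 - ω) * Real.exp (-d) with hcd
  have h := hd.affine_le (ω := ω) (A := -(1 - 2 * E)) (B := c * (1 + d - ω) - E ^ 2 * ω)
    (C := c * ω - E ^ 2 * (1 - ω)) (K := c) ?_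
  · rw [← hE] at h
    linarith
  · intro r hr
    have h2 := mul_le_mul_of_nonneg_left (exp_pointwise h0 h1 d hr) hc.le
    have h3 := posterior_le h0 h1 E hr
    rw [← mul_assoc, ← hcd] at h2
    linarith

/-- With `γ = (1 - ω) / ω`, `ω - E` is `ω` times the integral of `q (r - γ)⁺`. The tangent to
`klFun` at `t_γ` is `L (r - γ)`, and `klFun ≥ 0`, so `L (r - γ)⁺ ≤ klFun r`. -/
theorem HasDivergence.linear_bound {ω d : ℝ} (h0 : 0 < ω) (h1 : ω < 1 / 2)
    (hd : HasDivergence klFun P Q d) :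
    Real.log (tGamma ((1 - ω) / ω)) * (ω - bayesError ω P Q) ≤ ω * d := by
  have hγ : 1 < (1 - ω) / ω := by rw [lt_div_iff₀ h0]; linarith
  obtain ⟨h2, h3⟩ := tGamma_spec hγ
  set τ := tGamma ((1 - ω) / ω)
  set L := Real.log τ
  have hτ : 0 < τ := by linarith
  have h := hd.affine_le (ω := ω) (A := -L) (B := ω * L) (C := 0) (K := ω) ?_
  · linarith
  · intro r hr
    rcases le_total (ω * r) (1 - ω) with h | h
    · rw [min_eq_left h]
      have := mul_nonneg h0.le (klFun_nonneg hr)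
      linarith
    · rw [min_eq_right h]
      have h4 := mul_le_mul_of_nonneg_left (klFun_tangent_le hτ hr) h0.le
      have h5 : ω * (τ - 1) = (1 - ω) * L := by rw [h3]; field_simp
      linarith

theorem HasDivergence.pinsker_bound {d : ℝ} (hd : HasDivergence klFun P Q d) :
    8 * (1 / 2 - bayesError (1 / 2) P Q) ^ 2 ≤ d := by
  -- The Cauchy–Schwarz optimum: `∫ |p - q| = 4 (1/2 - E)` divided by `∫ (p + 2 q) = 3`.
  set s := 4 / 3 * (1 / 2 - bayesError (1 / 2) P Q) with hs
  have h := hd.affine_le (ω := 1 / 2) (A := -12 * s) (B := 3 * s - 3 / 2 * s ^ 2)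
    (C := 3 * s - 3 * s ^ 2) (K := 1) ?_
  · have e : bayesError (1 / 2) P Q = 1 / 2 - 3 / 4 * s := by rw [hs]; ring
    rw [e] at h ⊢
    linarith
  · intro r hr
    have h2 := pinsker_pointwise hr s
    have e : min (1 / 2 * r) (1 - 1 / 2) = 1 / 2 * min r 1 := by
      rw [mul_min_of_nonneg _ _ (by norm_num)]
      norm_num
    rw [e]
    linarith

lemma statInfo_le_of_le {ω x : ℝ} (h0 : 0 < ω) (h1 : ω ≤ 1 / 2)
    (h : x ≤ bayesError ω P Q - bayesError ω P Q ^ 2) :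
    statInfo ω P Q ≤ ((ω - 1 / 2 + √(1 / 4 - x) : ℝ) : EReal) := by
  rw [statInfo_eq h0 (by linarith), min_eq_left (by linarith), EReal.coe_le_coe_iff]
  have := Real.le_sqrt_of_sq_le (x := 1 / 2 - bayesError ω P Q) (y := 1 / 4 - x) (by linarith)
  linarith

lemma statInfo_le_of_nonpos {ω x : ℝ} (h0 : 0 < ω) (h1 : ω ≤ 1 / 2) (h : x ≤ 0) :
    statInfo ω P Q ≤ ((ω - 1 / 2 + √(1 / 4 - x) : ℝ) : EReal) := by
  rw [statInfo_eq h0 (by linarith), min_eq_left (by linarith), EReal.coe_le_coe_iff]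
  have := Real.le_sqrt_of_sq_le (x := 1 / 2) (y := 1 / 4 - x) (by linarith)
  have := bayesError_nonneg (P := P) (Q := Q) h0.le (by linarith)
  linarith

/-- The bound weakens as `c` grows. The freedom in `c` serves `ω > 1/2`, where the prior becomes `1
- ω` but the coefficient of `χ²` stays `ω`. -/
theorem statInfo_le_chiSq {ω c : ℝ} (h0 : 0 < ω) (h1 : ω ≤ 1 / 2) (hc : ω ≤ c) :
    statInfo ω P Q ≤ ((ω - 1 / 2 + √(1 / 4 - (((ω * (1 - ω) : ℝ) : EReal) /
      (1 + (c : EReal) * chiSq P Q)).toReal) : ℝ) : EReal) := by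
  rcases chiSq_eq_top_or_hasDivergence (P := P) (Q := Q) with h | ⟨d, hd0, hd, h⟩
  · apply statInfo_le_of_nonpos h0 h1
    rw [h, EReal.coe_mul_top_of_pos (by linarith), show (1 : EReal) + ⊤ = ⊤ from rfl,
      EReal.div_top, EReal.toReal_zero]
  · apply statInfo_le_of_le h0 h1
    refine le_trans ?_ (h.chiSq_bound h0 (by linarith) hd0)
    rw [hd, ← EReal.coe_mul, ← EReal.coe_one, ← EReal.coe_add, ← EReal.coe_div,
      EReal.toReal_coe]
    have : 0 ≤ ω * (1 - ω) := mul_nonneg h0.le (by linarith)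
    gcongr

theorem statInfo_le_expNeg {b ω : ℝ} (hb : 1 < b) (h0 : 0 < ω) (h1 : ω ≤ 1 / 2) :
    statInfo ω P Q ≤ ((ω - 1 / 2 + √(1 / 4 - ω * (1 - ω) * expNeg b (relEntropy b P Q)) : ℝ) :
      EReal) := by
  have hlb := Real.log_pos hb
  by_cases h : klDiv P Q = ⊤
  · apply statInfo_le_of_nonpos h0 h1
    simp [expNeg, relEntropy_eq_top h]
  · apply statInfo_le_of_le h0 h1
    rw [expNeg, relEntropy_eq_ofReal hb h, if_neg ENNReal.ofReal_ne_top,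
      ENNReal.toReal_ofReal (by positivity), Real.rpow_def_of_pos (by linarith)]
    rw [show Real.log b * -((klDiv P Q).toReal / Real.log b) = -(klDiv P Q).toReal by field_simp]
    exact (hasDivergence_klFun h).exp_bound h0 (by linarith)

theorem statInfo_le_cGamma_mul {b ω : ℝ} (hb : 1 < b) (h0 : 0 < ω) (h1 : ω < 1 / 2) :
    statInfo ω P Q ≤ ((ω * cGamma b ((1 - ω) / ω) : ℝ) : EReal) * (relEntropy b P Q : EReal) := by
  have hlb := Real.log_pos hb
  have hγ : 1 < (1 - ω) / ω := by rw [lt_div_iff₀ h0]; linarith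
  have hL : 0 < Real.log (tGamma ((1 - ω) / ω)) := Real.log_pos (hγ.trans (tGamma_spec hγ).1)
  rw [cGamma_eq hb hγ]
  by_cases h : klDiv P Q = ⊤
  · rw [relEntropy_eq_top h, EReal.coe_ennreal_top, EReal.coe_mul_top_of_pos (by positivity)]
    exact le_top
  · rw [relEntropy_eq_ofReal hb h, EReal.coe_ennreal_ofReal, max_eq_left (by positivity),
      ← EReal.coe_mul, statInfo_eq h0 (by linarith), min_eq_left (by linarith),
      EReal.coe_le_coe_iff]
    have := (hasDivergence_klFun h).linear_bound h0 h1
    rw [mul_comm, ← le_div_iff₀ hL] at this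
    refine this.trans_eq ?_
    field_simp

theorem statInfo_half_le {b : ℝ} (hb : 1 < b) :
    statInfo (1 / 2) P Q ≤ (((relEntropy b P Q /
      ENNReal.ofReal (8 * Real.logb b (Real.exp 1))) ^ (1 / 2 : ℝ) : ℝ≥0∞) : EReal) := by
  have hlb := Real.log_pos hb
  have hle : 0 < 8 * Real.logb b (Real.exp 1) := by
    rw [Real.logb, Real.log_exp]; positivity
  by_cases h : klDiv P Q = ⊤
  · rw [relEntropy_eq_top h, ENNReal.top_div_of_ne_top ENNReal.ofReal_ne_top,
      ENNReal.top_rpow_of_pos (by norm_num)]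
    exact le_top
  · rw [relEntropy_eq_ofReal hb h, ← ENNReal.ofReal_div_of_pos hle,
      ENNReal.ofReal_rpow_of_nonneg (by positivity) (by norm_num), EReal.coe_ennreal_ofReal,
      max_eq_left (by positivity), ← Real.sqrt_eq_rpow, statInfo_eq (by norm_num) (by norm_num),
      EReal.coe_le_coe_iff]
    have := (hasDivergence_klFun h).pinsker_bound
    apply Real.le_sqrt_of_sq_le
    have e : (klDiv P Q).toReal / Real.log b / (8 * Real.logb b (Real.exp 1)) =
        (klDiv P Q).toReal / 8 := by
      rw [Real.logb, Real.log_exp]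
      field_simp
    rw [e]
    norm_num at this ⊢
    linarith

end DeGroot

theorem theorem7 {α : Type*} [MeasurableSpace α] (P Q : Measure α)
    [IsProbabilityMeasure P] [IsProbabilityMeasure Q]
    (b : ℝ) (hb : 1 < b) (ω : ℝ) (hω0 : 0 < ω) (hω1 : ω < 1) :
    -- bounds by the chi-squared divergence
    ((ω ≤ 1 / 2 →
        DeGroot.statInfo ω P Q ≤
          ((ω - 1 / 2 + √(1 / 4 -
            (((ω * (1 - ω) : ℝ) : EReal) /
              (1 + (ω : EReal) * DeGroot.chiSq P Q)).toReal) : ℝ) : EReal)) ∧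
      (1 / 2 < ω →
        DeGroot.statInfo ω P Q ≤
          ((1 / 2 - ω + √(1 / 4 -
            (((ω * (1 - ω) : ℝ) : EReal) /
              (1 + (ω : EReal) * DeGroot.chiSq Q P)).toReal) : ℝ) : EReal))) ∧
    -- bounds linear in the relative entropy for `ω ≠ 1/2`, and the square-root bound at `1/2`
    ((ω < 1 / 2 →
        DeGroot.statInfo ω P Q ≤
          ((ω * DeGroot.cGamma b ((1 - ω) / ω) : ℝ) : EReal) *
            (DeGroot.relEntropy b P Q : EReal)) ∧
      (ω = 1 / 2 →
        DeGroot.statInfo ω P Q ≤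
          (((min (DeGroot.relEntropy b P Q) (DeGroot.relEntropy b Q P) /
            ENNReal.ofReal (8 * Real.logb b (Real.exp 1))) ^ (1 / 2 : ℝ) : ℝ≥0∞) : EReal)) ∧
      (1 / 2 < ω →
        DeGroot.statInfo ω P Q ≤
          (((1 - ω) * DeGroot.cGamma b (ω / (1 - ω)) : ℝ) : EReal) *
            (DeGroot.relEntropy b Q P : EReal))) ∧
    -- bounds by the exponential of the negative relative entropy
    ((ω ≤ 1 / 2 →
        DeGroot.statInfo ω P Q ≤
          ((ω - 1 / 2 + √(1 / 4 -
            ω * (1 - ω) * DeGroot.expNeg b (DeGroot.relEntropy b P Q)) : ℝ) : EReal)) ∧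
      (1 / 2 < ω →
        DeGroot.statInfo ω P Q ≤
          ((1 / 2 - ω + √(1 / 4 -
            ω * (1 - ω) * DeGroot.expNeg b (DeGroot.relEntropy b Q P)) : ℝ) : EReal))) := by

  have hs := DeGroot.statInfo_symm (P := P) (Q := Q) hω0 hω1
  have h0 : 0 < 1 - ω := by linarith
  refine ⟨⟨fun h => DeGroot.statInfo_le_chiSq hω0 h le_rfl, fun h => ?_⟩,
    ⟨fun h => DeGroot.statInfo_le_cGamma_mul hb hω0 h, fun h => ?_, fun h => ?_⟩,
    fun h => DeGroot.statInfo_le_expNeg hb hω0 h, fun h => ?_⟩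
  -- `c = ω` exceeds the swapped prior `1 - ω`.
  · have := DeGroot.statInfo_le_chiSq (P := Q) (Q := P) (c := ω) h0 (by linarith) (by linarith)
    rw [hs, show 1 / 2 - ω = 1 - ω - 1 / 2 by ring,
      show ω * (1 - ω) = (1 - ω) * (1 - (1 - ω)) by ring]
    exact this
  · subst h
    rcases min_choice (DeGroot.relEntropy b P Q) (DeGroot.relEntropy b Q P) with h | h
    · rw [h]
      exact DeGroot.statInfo_half_le hb
    · rw [h, hs, show (1 : ℝ) - 1 / 2 = 1 / 2 by norm_num]
      exact DeGroot.statInfo_half_le hb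
  · have := DeGroot.statInfo_le_cGamma_mul (P := Q) (Q := P) hb h0 (by linarith)
    rwa [sub_sub_cancel, ← hs] at this
  · have := DeGroot.statInfo_le_expNeg (P := Q) (Q := P) hb h0 (by linarith)
    rw [hs, show 1 / 2 - ω = 1 - ω - 1 / 2 by ring,
      show ω * (1 - ω) = (1 - ω) * (1 - (1 - ω)) by ring]
    exact this
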